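/- For a set of $k$ generators ($2\le k<\infty$, or countably infinitely many generators when $k=\infty$), let $P_k$ be the free monoid of all words in the generators (including the empty word), and let $\ell_2(P_k)$ be the full Fock space, that is, the complex Hilbert space with orthonormal basis $\{e_w: w\in P_k\}$. For $w\in P_k$ let $L_w\in B(\ell_2(P_k))$ be the isometry of left multiplication by $w$, $L_w e_v=e_{wv}$. Let $\mathbb A(k)$, Popescu's noncommutative disc algebra, be the closure in the operator norm of $B(\ell_2(P_k))$ of the linear span of $\{L_w: w\in P_k\}$, i.e. of the polynomials in the left creation operators $L_g$, $g$ a generator. For a closed subspace $X\subset B(H)$, $M_n(X)$ carries the norm inherited from $M_n(B(H))=B(\ell_2^n(H))$. A linear map $u:X\to Y$ between such spaces is completely bounded if $\sup_{n\ge 1}\|u_n\|<\infty$, where $u_n:M_n(X)\to M_n(Y)$, $u_n[(x_{ij})]=[(u(x_{ij}))]$; and $X$ and $Y$ are completely isomorphic if there is a linear bijection $u:X\to Y$ such that $u$ and $u^{-1}$ are completely bounded. Theorem. For every integer $k\ge 2$, $\mathbb A(k)$ is completely isomorphic to $\mathbb A(\infty)$. -/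

import Mathlib

noncomputable section

namespace NCDisc

/-! ### Operator spaces and completely bounded maps -/

section OperatorSpaces

variable {H K : Type*}
  [NormedAddCommGroup H] [InnerProductSpace ℂ H] [NormedAddCommGroup K] [InnerProductSpace ℂ K]

/-- The operator on `ℓ₂ⁿ(H) = H ⊕ ⋯ ⊕ H` given by an `n × n` matrix of operators on `H`:
`(x ξ)ᵢ = ∑ⱼ xᵢⱼ ξⱼ`. -/
def matrixOp {n : ℕ} (x : Matrix (Fin n) (Fin n) (H →L[ℂ] H)) :
    PiLp 2 (fun _ : Fin n => H) →L[ℂ] PiLp 2 (fun _ : Fin n => H) :=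
  ((PiLp.continuousLinearEquiv 2 ℂ (fun _ : Fin n => H)).symm :
      (Fin n → H) →L[ℂ] PiLp 2 (fun _ : Fin n => H)).comp
    (ContinuousLinearMap.pi fun i =>
      ∑ j, (x i j).comp (PiLp.proj 2 (fun _ : Fin n => H) j))

theorem matrixOp_apply {n : ℕ} (x : Matrix (Fin n) (Fin n) (H →L[ℂ] H))
    (ξ : PiLp 2 (fun _ : Fin n => H)) (i : Fin n) :
    matrixOp x ξ i = ∑ j, x i j (ξ j) := by
  simp [matrixOp]

/-- The norm on `Mₙ(X)`, for a subspace `X` of `B(H)`, inherited from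
`Mₙ(B(H)) = B(ℓ₂ⁿ(H))`. -/
def matrixNorm (X : Submodule ℂ (H →L[ℂ] H)) {n : ℕ} (x : Matrix (Fin n) (Fin n) X) : ℝ :=
  ‖matrixOp (x.map fun a => (a : H →L[ℂ] H))‖

/-- A linear map `u : X → Y` between subspaces of `B(H)` and `B(K)` is completely bounded if the
maps `uₙ : Mₙ(X) → Mₙ(Y)`, `uₙ [(xᵢⱼ)] = [(u xᵢⱼ)]`, are bounded uniformly in `n`. -/
def CompletelyBounded {X : Submodule ℂ (H →L[ℂ] H)} {Y : Submodule ℂ (K →L[ℂ] K)}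
    (u : X →ₗ[ℂ] Y) : Prop :=
  ∃ c : ℝ, ∀ (n : ℕ) (x : Matrix (Fin n) (Fin n) X),
    matrixNorm Y (x.map u) ≤ c * matrixNorm X x

/-- `X` and `Y` are completely isomorphic: there is a linear bijection `u : X → Y` such that
`u` and `u⁻¹` are completely bounded. -/
def CompletelyIsomorphic (X : Submodule ℂ (H →L[ℂ] H)) (Y : Submodule ℂ (K →L[ℂ] K)) : Prop :=
  ∃ u : X ≃ₗ[ℂ] Y,
    CompletelyBounded (u : X →ₗ[ℂ] Y) ∧ CompletelyBounded (u.symm : Y →ₗ[ℂ] X)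

end OperatorSpaces

/-! ### The full Fock space and the noncommutative disc algebra -/

variable (α : Type*)

/-- The full Fock space on the generators `α`: the Hilbert space `ℓ₂(P)`, with `P` the free monoid
of words in `α`. -/
abbrev FockSpace : Type _ := lp (fun _ : FreeMonoid α => ℂ) 2

variable {α}

open scoped Classical in
/-- The basis vector `e_w` of the Fock space. -/
def basisVec (w : FreeMonoid α) : FockSpace α := lp.single 2 w 1

theorem orthonormal_basisVec : Orthonormal ℂ (basisVec (α := α)) := by
  classical
  rw [orthonormal_iff_ite]
  intro v w
  simp only [basisVec, lp.inner_single_left, lp.single_apply, Pi.single_apply]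
  split_ifs <;> simp

theorem orthonormal_basisVec_mul (w : FreeMonoid α) :
    Orthonormal ℂ (fun v => basisVec (w * v)) :=
  orthonormal_basisVec.comp (fun v => w * v) (mul_right_injective w)

/-- Left multiplication by the word `w`: the isometry of the Fock space with
`e_v ↦ e_{wv}` for every word `v`. -/
def leftMul (w : FreeMonoid α) : FockSpace α →L[ℂ] FockSpace α :=
  (orthonormal_basisVec_mul w).orthogonalFamily.linearIsometry.toContinuousLinearMap

theorem leftMul_basisVec (w v : FreeMonoid α) :
    leftMul w (basisVec v) = basisVec (w * v) := by
  classical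
  simp only [leftMul, LinearIsometry.coe_toContinuousLinearMap]
  rw [basisVec, OrthogonalFamily.linearIsometry_apply_single]
  simp

/-- The left creation operator of the generator `i`. -/
def creation (i : α) : FockSpace α →L[ℂ] FockSpace α := leftMul (FreeMonoid.of i)

variable (α) in
/-- The operators of left multiplication by the elements of `ℓ₂(P)` of finite support, that is,
the linear span of the left multiplications by words. -/
def polynomials : Submodule ℂ (FockSpace α →L[ℂ] FockSpace α) :=
  Submodule.span ℂ (Set.range (leftMul (α := α)))

variable (α) in
/-- The noncommutative disc algebra on the generators `α`, as a closed subspace of the bounded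
operators on the Fock space: the norm closure of the polynomials. -/
def discAlgebra : Submodule ℂ (FockSpace α →L[ℂ] FockSpace α) :=
  (polynomials α).topologicalClosure

theorem ext_basisVec {S T : FockSpace α →L[ℂ] FockSpace α}
    (h : ∀ v, S (basisVec v) = T (basisVec v)) : S = T := by
  classical
  refine lp.ext_continuousLinearMap (by simp) fun v => ?_
  refine ContinuousLinearMap.ext_ring ?_
  simpa [basisVec] using h v

theorem leftMul_one : leftMul (1 : FreeMonoid α) = 1 :=
  ext_basisVec fun v => by simp [leftMul_basisVec]

theorem leftMul_mul (w v : FreeMonoid α) : leftMul (w * v) = leftMul w * leftMul v :=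
  ext_basisVec fun x => by simp [leftMul_basisVec, mul_assoc]

/-- The polynomials are the algebra generated by the left creation operators. -/
theorem polynomials_eq_adjoin :
    polynomials α = Subalgebra.toSubmodule (Algebra.adjoin ℂ (Set.range (creation (α := α)))) := by
  let φ : FreeMonoid α →* (FockSpace α →L[ℂ] FockSpace α) :=
    { toFun := leftMul, map_one' := leftMul_one, map_mul' := leftMul_mul }
  have h : (Submonoid.closure (Set.range (creation (α := α))) : Set _) =
      Set.range (leftMul (α := α)) := by
    have h1 : Set.range (creation (α := α)) = φ '' Set.range FreeMonoid.of := by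
      rw [← Set.range_comp]; rfl
    rw [h1, ← MonoidHom.map_mclosure, FreeMonoid.closure_range_of, ← MonoidHom.mrange_eq_map]
    rfl
  rw [Algebra.adjoin_eq_span, h, polynomials]

end NCDisc

end

open scoped ENNReal NNReal

/-! The argument is Pełczyński's decomposition method, run on polynomials (the free monoid algebra)
and carried to the norm closures only at the end. Write X for the polynomials in k generators and Y
for those in countably many. Three complementation facts are needed.

X is complemented in Y, and Y in X, through bifix codes: families of nonempty words in which no word
is a prefix or a suffix of another. The prefix condition makes every word uniquely a product of code
words times a remainder t, so the Fock space is an orthogonal sum, over t, of copies of the Fock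
space of the code. An element spelled in code words acts diagonally on these copies, so the
embedding is completely contractive (`IsBifixCode.isCB_mapDomain`). The suffix condition makes
compression to the span of the products of code words the restriction of coefficients, which is
therefore a completely contractive left inverse (`IsBifixCode.isCB_comapDomain`). Distinct letters
form a code, and so do the words a bⁿ a in two letters.

The space of columns over Y is complemented in Y: since the creation operators are isometries with
orthogonal ranges, the column (y_g) has the norm of ∑ g y_g, and such sums are exactly the
polynomials without constant term (`retract_col_wordSpace`).

Bounds are recorded for arrays with arbitrarily many rows because a column adds its index set to the
rows; only square arrays matter in the end. All bounds are on squared norms, with values in `ℝ≥0∞`,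
so infinitely many rows raise no question of summability. -/

/-- A complex vector space with, for each `c`, a distinguished set of arrays with finitely many
columns and arbitrarily many rows, thought of as the arrays whose norm, as operators between
column spaces, has square at most `c`. -/
structure ColumnSpace where
  carrier : Type
  [addCommGroup : AddCommGroup carrier]
  [module : Module ℂ carrier]
  Bound : ∀ {ι : Type} {n : ℕ}, (ι → Fin n → carrier) → ℝ≥0∞ → Prop
  bound_mono : ∀ {ι : Type} {n : ℕ} {x : ι → Fin n → carrier} {c d : ℝ≥0∞},
    c ≤ d → Bound x c → Bound x d
  bound_add : ∀ {ι : Type} {n : ℕ} {x y : ι → Fin n → carrier} {c : ℝ≥0∞},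
    Bound x c → Bound y c → Bound (x + y) (4 * c)
  bound_neg : ∀ {ι : Type} {n : ℕ} {x : ι → Fin n → carrier} {c : ℝ≥0∞},
    Bound x c → Bound (-x) c
  bound_comp : ∀ {ι ι' : Type} {n : ℕ} {x : ι → Fin n → carrier} {c : ℝ≥0∞} {f : ι' → ι},
    Function.Injective f → Bound x c → Bound (x ∘ f) c
  bound_sum : ∀ {ι ι' : Type} {n : ℕ} {x : ι ⊕ ι' → Fin n → carrier} {c : ℝ≥0∞},
    Bound (x ∘ Sum.inl) c → Bound (x ∘ Sum.inr) c → Bound x (2 * c)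

noncomputable section

/-! ### Completely bounded maps between column spaces -/

namespace ColumnSpace

instance : CoeSort ColumnSpace Type := ⟨carrier⟩

instance (X : ColumnSpace) : AddCommGroup X := X.addCommGroup

instance (X : ColumnSpace) : Module ℂ X := X.module

/-- Linear maps which are bounded uniformly on arrays of all sizes. -/
def IsCB {X Y : ColumnSpace} (u : X →ₗ[ℂ] Y) : Prop :=
  ∃ K : ℝ≥0, ∀ {ι : Type} {n : ℕ} (x : ι → Fin n → X) (c : ℝ≥0∞),
    X.Bound x c → Y.Bound (fun i j => u (x i j)) (K * c)

/-- `X` and `Y` are completely isomorphic. -/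
def Equivalent (X Y : ColumnSpace) : Prop :=
  ∃ u : X ≃ₗ[ℂ] Y, IsCB (u : X →ₗ[ℂ] Y) ∧ IsCB (u.symm : Y →ₗ[ℂ] X)

/-- `X` is completely isomorphic to a completely complemented subspace of `Y`. -/
def Retract (X Y : ColumnSpace) : Prop :=
  ∃ (a : X →ₗ[ℂ] Y) (b : Y →ₗ[ℂ] X), IsCB a ∧ IsCB b ∧ ∀ x, b (a x) = x

variable {X X' Y Y' Z : ColumnSpace}

theorem isCB_of_forall {u : X →ₗ[ℂ] Y}
    (h : ∀ {ι : Type} {n : ℕ} (x : ι → Fin n → X) (c : ℝ≥0∞),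
      X.Bound x c → Y.Bound (fun i j => u (x i j)) c) : IsCB u :=
  ⟨1, fun x c hx => by simpa using h x c hx⟩

theorem isCB_id : IsCB (LinearMap.id : X →ₗ[ℂ] X) := isCB_of_forall fun _ _ h => h

theorem IsCB.comp {v : Y →ₗ[ℂ] Z} {u : X →ₗ[ℂ] Y} (hv : IsCB v) (hu : IsCB u) :
    IsCB (v ∘ₗ u) := by
  obtain ⟨K, hK⟩ := hv
  obtain ⟨L, hL⟩ := hu
  refine ⟨K * L, fun x c h => ?_⟩
  simpa [mul_assoc] using hK _ _ (hL x c h)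

theorem IsCB.neg {u : X →ₗ[ℂ] Y} (hu : IsCB u) : IsCB (-u) := by
  obtain ⟨K, hK⟩ := hu
  exact ⟨K, fun x c h => Y.bound_neg (hK x c h)⟩

theorem IsCB.add {u v : X →ₗ[ℂ] Y} (hu : IsCB u) (hv : IsCB v) : IsCB (u + v) := by
  obtain ⟨K, hK⟩ := hu
  obtain ⟨L, hL⟩ := hv
  refine ⟨4 * (K + L), fun x c h => ?_⟩
  have h1 := Y.bound_mono (d := (K + L : ℝ≥0) * c) (by gcongr; simp) (hK x c h)
  have h2 := Y.bound_mono (d := (K + L : ℝ≥0) * c) (by gcongr; simp) (hL x c h)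
  have := Y.bound_add h1 h2
  rw [← mul_assoc] at this
  exact_mod_cast this

theorem IsCB.sub {u v : X →ₗ[ℂ] Y} (hu : IsCB u) (hv : IsCB v) : IsCB (u - v) := by
  rw [sub_eq_add_neg]
  exact hu.add hv.neg

theorem Equivalent.symm (h : Equivalent X Y) : Equivalent Y X := by
  obtain ⟨u, hu, hv⟩ := h
  exact ⟨u.symm, hv, by simpa using hu⟩

theorem Equivalent.trans (h : Equivalent X Y) (h' : Equivalent Y Z) : Equivalent X Z := by
  obtain ⟨u, hu, hv⟩ := h
  obtain ⟨u', hu', hv'⟩ := h'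
  exact ⟨u.trans u', hu'.comp hu, hv.comp hv'⟩

theorem Equivalent.refl (X : ColumnSpace) : Equivalent X X :=
  ⟨LinearEquiv.refl ℂ X, isCB_id, isCB_id⟩

/-! ### Direct sums, subspaces and columns -/

/-- The direct sum of two spaces. -/
protected def prod (X Y : ColumnSpace) : ColumnSpace where
  carrier := X × Y
  Bound x c := X.Bound (fun i j => (x i j).1) c ∧ Y.Bound (fun i j => (x i j).2) c
  bound_mono hcd h := ⟨X.bound_mono hcd h.1, Y.bound_mono hcd h.2⟩
  bound_add h h' := ⟨X.bound_add h.1 h'.1, Y.bound_add h.2 h'.2⟩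
  bound_neg h := ⟨X.bound_neg h.1, Y.bound_neg h.2⟩
  bound_comp hf h := ⟨X.bound_comp hf h.1, Y.bound_comp hf h.2⟩
  bound_sum h h' := ⟨X.bound_sum h.1 h'.1, Y.bound_sum h.2 h'.2⟩

/-- A subspace, with the inherited structure. -/
def sub (X : ColumnSpace) (S : Submodule ℂ X) : ColumnSpace where
  carrier := S
  Bound x c := X.Bound (fun i j => (x i j : X)) c
  bound_mono hcd h := X.bound_mono hcd h
  bound_add h h' := X.bound_add h h'
  bound_neg h := X.bound_neg h
  bound_comp hf h := X.bound_comp hf h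
  bound_sum h h' := X.bound_sum h h'

/-- Finitely supported columns, indexed by `J`, with entries in a space. -/
def col (J : Type) (X : ColumnSpace) : ColumnSpace where
  carrier := J →₀ X
  Bound {ι n} x c := X.Bound (ι := ι × J) (fun i j => x i.1 j i.2) c
  bound_mono hcd h := X.bound_mono hcd h
  bound_add h h' := X.bound_add h h'
  bound_neg h := X.bound_neg h
  bound_comp hf h := X.bound_comp (hf.prodMap Function.injective_id) h
  bound_sum {ι ι' n x c} h h' := by
    have := X.bound_sum (x := fun i j => x ((Equiv.sumProdDistrib ι ι' J).symm i).1 j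
      ((Equiv.sumProdDistrib ι ι' J).symm i).2) h h'
    have := X.bound_comp (Equiv.sumProdDistrib ι ι' J).injective this
    simpa [Function.comp_def] using this

theorem isCB_fst : IsCB (X := X.prod Y) (Y := X) (LinearMap.fst ℂ X Y) :=
  isCB_of_forall fun _ _ h => h.1

theorem isCB_snd : IsCB (X := X.prod Y) (Y := Y) (LinearMap.snd ℂ X Y) :=
  isCB_of_forall fun _ _ h => h.2

theorem IsCB.prod {u : Z →ₗ[ℂ] X} {v : Z →ₗ[ℂ] Y} (hu : IsCB u) (hv : IsCB v) :
    IsCB (X := Z) (Y := X.prod Y) (LinearMap.prod u v) := by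
  obtain ⟨K, hK⟩ := hu
  obtain ⟨L, hL⟩ := hv
  refine ⟨K + L, fun x c h => ⟨?_, ?_⟩⟩
  · exact X.bound_mono (by gcongr; simp) (hK x c h)
  · exact Y.bound_mono (by gcongr; simp) (hL x c h)

theorem isCB_subtype (S : Submodule ℂ X) : IsCB (X := X.sub S) (Y := X) S.subtype :=
  isCB_of_forall fun _ _ h => h

theorem IsCB.codRestrict {u : X →ₗ[ℂ] Y} (hu : IsCB u) (S : Submodule ℂ Y) (h : ∀ x, u x ∈ S) :
    IsCB (X := X) (Y := Y.sub S) (u.codRestrict S h) := by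
  obtain ⟨K, hK⟩ := hu
  exact ⟨K, fun x c h => hK x c h⟩

theorem IsCB.mapRange {u : X →ₗ[ℂ] Y} (hu : IsCB u) (J : Type) :
    IsCB (X := col J X) (Y := col J Y) (Finsupp.mapRange.linearMap (α := J) u) := by
  obtain ⟨K, hK⟩ := hu
  exact ⟨K, fun x c h => hK _ c h⟩

theorem Equivalent.prodCongr (h : Equivalent X X') (h' : Equivalent Y Y') :
    Equivalent (X.prod Y) (X'.prod Y') := by
  obtain ⟨u, hu, hv⟩ := h
  obtain ⟨u', hu', hv'⟩ := h'
  exact ⟨LinearEquiv.prodCongr u u', (hu.comp isCB_fst).prod (hu'.comp isCB_snd),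
    (hv.comp isCB_fst).prod (hv'.comp isCB_snd)⟩

theorem equivalent_prodComm (X Y : ColumnSpace) : Equivalent (X.prod Y) (Y.prod X) :=
  ⟨LinearEquiv.prodComm ℂ X Y, isCB_snd.prod isCB_fst, isCB_snd.prod isCB_fst⟩

theorem equivalent_prodAssoc (X Y Z : ColumnSpace) :
    Equivalent ((X.prod Y).prod Z) (X.prod (Y.prod Z)) :=
  ⟨LinearEquiv.prodAssoc ℂ X Y Z,
    (isCB_fst.comp isCB_fst).prod ((isCB_snd.comp isCB_fst).prod isCB_snd),
    (isCB_fst.prod (isCB_fst.comp isCB_snd)).prod (isCB_snd.comp isCB_snd)⟩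

theorem Equivalent.colCongr (h : Equivalent X Y) (J : Type) :
    Equivalent (col J X) (col J Y) := by
  obtain ⟨u, hu, hv⟩ := h
  exact ⟨Finsupp.mapRange.linearEquiv u, hu.mapRange J, hv.mapRange J⟩

theorem equivalent_col_of_equiv {J J' : Type} (e : J ≃ J') (X : ColumnSpace) :
    Equivalent (col J X) (col J' X) := by
  refine ⟨Finsupp.domLCongr e, isCB_of_forall fun {ι n} x c h => ?_,
    isCB_of_forall fun {ι n} x c h => ?_⟩
  · exact X.bound_comp ((Equiv.refl ι).prodCongr e.symm).injective h
  · exact X.bound_comp ((Equiv.refl ι).prodCongr e).injective h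

theorem equivalent_col_sum (J J' : Type) (X : ColumnSpace) :
    Equivalent (col (J ⊕ J') X) ((col J X).prod (col J' X)) := by
  refine ⟨Finsupp.sumFinsuppLEquivProdFinsupp ℂ, isCB_of_forall fun {ι n} x c h => ⟨?_, ?_⟩,
    ⟨2, fun {ι n} x c h => ?_⟩⟩
  · exact X.bound_comp (f := Prod.map id Sum.inl)
      (Function.injective_id.prodMap Sum.inl_injective) h
  · exact X.bound_comp (f := Prod.map id Sum.inr)
      (Function.injective_id.prodMap Sum.inr_injective) h
  -- The constant 2 appears because the squared norms of two stacked blocks add up.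
  · have := X.bound_sum (x := fun i j => (Finsupp.sumFinsuppLEquivProdFinsupp ℂ).symm
      (x ((Equiv.prodSumDistrib ι J J').symm i).1 j)
      ((Equiv.prodSumDistrib ι J J').symm i).2) (c := c) h.1 h.2
    have := X.bound_comp (Equiv.prodSumDistrib ι J J').injective this
    simp only [Function.comp_def, Equiv.symm_apply_apply] at this
    exact this

theorem equivalent_col_unit (X : ColumnSpace) : Equivalent (col Unit X) X := by
  refine ⟨Finsupp.uniqueLinearEquiv ℂ X (), isCB_of_forall fun {ι n} x c h => ?_,
    isCB_of_forall fun {ι n} x c h => ?_⟩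
  · exact X.bound_comp (Equiv.prodPUnit ι).symm.injective h
  · have := X.bound_comp (Equiv.prodPUnit ι).injective h
    refine (congrArg (X.Bound · c) (funext₂ fun i j => ?_)).mp this
    exact ((Finsupp.uniqueLinearEquiv ℂ X ()).apply_symm_apply (x i.1 j)).symm

theorem equivalent_col_prod (J : Type) (X Y : ColumnSpace) :
    Equivalent (col J (X.prod Y)) ((col J X).prod (col J Y)) := by
  let f : (J →₀ X × Y) →ₗ[ℂ] (J →₀ X) × (J →₀ Y) :=
    (Finsupp.mapRange.linearMap (LinearMap.fst ℂ X Y)).prod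
      (Finsupp.mapRange.linearMap (LinearMap.snd ℂ X Y))
  let g : (J →₀ X) × (J →₀ Y) →ₗ[ℂ] (J →₀ X × Y) :=
    (Finsupp.mapRange.linearMap (LinearMap.inl ℂ X Y)).coprod
      (Finsupp.mapRange.linearMap (LinearMap.inr ℂ X Y))
  have hfg : f ∘ₗ g = LinearMap.id := by ext <;> simp [f, g]
  have hgf : g ∘ₗ f = LinearMap.id := by ext <;> simp [f, g]
  have hg : ∀ z i, g z i = (z.1 i, z.2 i) := fun z i => by simp [g]
  have hg_cb : IsCB (X := (col J X).prod (col J Y)) (Y := col J (X.prod Y)) g :=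
    isCB_of_forall fun {ι n} (x : ι → Fin n → (J →₀ X) × (J →₀ Y)) c h => by
      change X.Bound (fun (i : ι × J) j => (g (x i.1 j) i.2).1) c ∧
        Y.Bound (fun (i : ι × J) j => (g (x i.1 j) i.2).2) c
      simp only [hg]
      exact h
  exact ⟨LinearEquiv.ofLinearMap f g hfg hgf, (isCB_fst.mapRange J).prod (isCB_snd.mapRange J),
    hg_cb⟩

/-! ### Complemented subspaces and the decomposition method -/

/-- The complement is the kernel of the retraction `b`, by the splitting y = a(b y) + (y - a(b y)).
-/
theorem Retract.exists_equivalent_prod (h : Retract X Y) : ∃ Z, Equivalent Y (X.prod Z) := by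
  obtain ⟨a, b, ha, hb, hab⟩ := h
  have hc : ∀ y, (LinearMap.id - a ∘ₗ b : Y →ₗ[ℂ] Y) y ∈ LinearMap.ker b := fun y => by
    simp [hab]
  let p : Y →ₗ[ℂ] LinearMap.ker b := (LinearMap.id - a ∘ₗ b).codRestrict _ hc
  have hp : IsCB (Y := Y.sub (LinearMap.ker b)) p := (isCB_id.sub (ha.comp hb)).codRestrict _ hc
  let f : Y →ₗ[ℂ] X × LinearMap.ker b := b.prod p
  let g : X × LinearMap.ker b →ₗ[ℂ] Y :=
    a ∘ₗ LinearMap.fst ℂ _ _ + (LinearMap.ker b).subtype ∘ₗ LinearMap.snd ℂ _ _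
  have hfg : f ∘ₗ g = LinearMap.id := by
    refine LinearMap.ext fun z => ?_
    have : b z.2 = 0 := z.2.2
    refine Prod.ext ?_ (Subtype.ext ?_) <;> simp [f, g, p, hab, this]
  have hgf : g ∘ₗ f = LinearMap.id := by
    refine LinearMap.ext fun z => ?_
    simp [f, g, p]
  exact ⟨Y.sub (LinearMap.ker b), LinearEquiv.ofLinearMap f g hfg hgf, hb.prod hp,
    (ha.comp isCB_fst).add ((isCB_subtype _).comp isCB_snd)⟩

theorem equivalent_prod_col (X : ColumnSpace) : Equivalent (col ℕ X) (X.prod (col ℕ X)) :=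
  (equivalent_col_of_equiv ((Equiv.natSumPUnitEquivNat).symm.trans (Equiv.sumComm _ _)) X).trans
    ((equivalent_col_sum _ _ X).trans ((equivalent_col_unit X).prodCongr (.refl _)))

theorem equivalent_col_prod_col (X : ColumnSpace) :
    Equivalent (col ℕ X) ((col ℕ X).prod (col ℕ X)) :=
  (equivalent_col_of_equiv Equiv.natSumNatEquivNat.symm X).trans (equivalent_col_sum _ _ X)

/-- With X ≅ col X ⊕ Z and col X ≅ col X ⊕ col X, the space X absorbs col X; conversely col X
absorbs X, because ℕ ≅ ℕ + 1. Hence X ≅ X ⊕ col X ≅ col X. -/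
theorem equivalent_col_of_retract (h : Retract (col ℕ X) X) : Equivalent X (col ℕ X) := by
  obtain ⟨Z, hZ⟩ := h.exists_equivalent_prod
  have h1 : Equivalent (X.prod (col ℕ X)) X :=
    (hZ.prodCongr (.refl _)).trans <| (equivalent_prodComm _ _).trans <|
      (equivalent_prodAssoc _ _ _).symm.trans <|
      ((equivalent_col_prod_col X).symm.prodCongr (.refl _)).trans hZ.symm
  exact h1.symm.trans (equivalent_prod_col X).symm

/-- **Pełczyński's decomposition method**: two spaces which are complemented in each other are
isomorphic, provided one of them absorbs columns over itself. -/
theorem equivalent_of_retract (hXY : Retract X Y) (hYX : Retract Y X)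
    (hY : Retract (col ℕ Y) Y) : Equivalent X Y := by
  obtain ⟨W, hW⟩ := hXY.exists_equivalent_prod
  obtain ⟨Z, hZ⟩ := hYX.exists_equivalent_prod
  have hcol := equivalent_col_of_retract hY
  have hYY : Equivalent Y (Y.prod Y) :=
    hcol.trans <| (equivalent_col_prod_col Y).trans (hcol.symm.prodCongr hcol.symm)
  -- Y ≅ col Y ≅ col X ⊕ col W, and col X absorbs one more copy of X.
  have h1 : Equivalent Y (X.prod Y) := by
    have h2 : Equivalent Y ((col ℕ X).prod (col ℕ W)) :=
      hcol.trans <| (hW.colCongr ℕ).trans (equivalent_col_prod _ _ _)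
    exact h2.trans <| ((equivalent_prod_col X).prodCongr (.refl _)).trans <|
      (equivalent_prodAssoc _ _ _).trans ((Equivalent.refl X).prodCongr h2.symm)
  -- X ≅ Y ⊕ Z absorbs Y because Y ≅ Y ⊕ Y.
  have h3 : Equivalent (X.prod Y) X :=
    (hZ.prodCongr (.refl _)).trans <| (equivalent_prodComm _ _).trans <|
      (equivalent_prodAssoc _ _ _).symm.trans <| (hYY.symm.prodCongr (.refl _)).trans hZ.symm
  exact (h1.trans h3).symm

end ColumnSpace

end

noncomputable section

/-! ### Square sums of families of elements of a free monoid algebra -/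

namespace MonoidAlgebra

/-- The sum of the squares of all coefficients of a family of elements. -/
def sqNorm {ι S : Type} (ξ : ι → MonoidAlgebra ℂ S) : ℝ≥0∞ :=
  ∑' i, ∑' w, ‖(ξ i).coeff w‖ₑ ^ 2

variable {ι ι' S T : Type}

theorem sqNorm_add_le (ξ η : ι → MonoidAlgebra ℂ S) :
    sqNorm (ξ + η) ≤ 2 * (sqNorm ξ + sqNorm η) := by
  simp only [sqNorm, ← ENNReal.tsum_add, ← ENNReal.tsum_mul_left]
  refine ENNReal.tsum_le_tsum fun i => ENNReal.tsum_le_tsum fun w => ?_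
  have h : ‖(ξ i).coeff w + (η i).coeff w‖₊ ^ 2 ≤
      2 * (‖(ξ i).coeff w‖₊ ^ 2 + ‖(η i).coeff w‖₊ ^ 2) :=
    (pow_le_pow_left₀ zero_le (nnnorm_add_le _ _) 2).trans add_sq_le
  change (‖(ξ i).coeff w + (η i).coeff w‖₊ : ℝ≥0∞) ^ 2 ≤
    2 * ((‖(ξ i).coeff w‖₊ : ℝ≥0∞) ^ 2 + (‖(η i).coeff w‖₊ : ℝ≥0∞) ^ 2)
  exact_mod_cast h

theorem sqNorm_neg (ξ : ι → MonoidAlgebra ℂ S) : sqNorm (-ξ) = sqNorm ξ := by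
  simp [sqNorm]

theorem sqNorm_comp_le {f : ι' → ι} (hf : Function.Injective f) (ξ : ι → MonoidAlgebra ℂ S) :
    sqNorm (ξ ∘ f) ≤ sqNorm ξ :=
  ENNReal.tsum_comp_le_tsum_of_injective hf fun i => ∑' w, ‖(ξ i).coeff w‖ₑ ^ 2

theorem sqNorm_sum (ξ : ι ⊕ ι' → MonoidAlgebra ℂ S) :
    sqNorm ξ = sqNorm (ξ ∘ Sum.inl) + sqNorm (ξ ∘ Sum.inr) :=
  Summable.tsum_sum ENNReal.summable ENNReal.summable

theorem sqNorm_mapDomain {f : S → T} (hf : Function.Injective f) (ξ : ι → MonoidAlgebra ℂ S) :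
    sqNorm (fun i => mapDomain f (ξ i)) = sqNorm ξ := by
  refine tsum_congr fun i => ?_
  rw [← hf.tsum_eq]
  · simp [mapDomain, Finsupp.mapDomain_apply hf]
  · intro t ht
    by_contra h
    exact ht (by simp [mapDomain, Finsupp.mapDomain_of_notMem_range _ _ h])

theorem sqNorm_comapDomain_le {f : S → T} (hf : Function.Injective f)
    (ξ : ι → MonoidAlgebra ℂ T) :
    sqNorm (fun i => comapDomain f hf (ξ i)) ≤ sqNorm ξ :=
  ENNReal.tsum_le_tsum fun i =>
    ENNReal.tsum_comp_le_tsum_of_injective hf fun w => ‖(ξ i).coeff w‖ₑ ^ 2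

theorem sqNorm_prod {J : Type} (ξ : ι × J → MonoidAlgebra ℂ S) :
    sqNorm ξ = ∑' j, sqNorm fun i => ξ (i, j) := by
  simp only [sqNorm]
  rw [ENNReal.tsum_prod', ENNReal.tsum_comm]

/-- Parseval for the decomposition of the index set into the disjoint images of the `f j`; outside
them the coefficients vanish by `hξ`. -/
theorem tsum_sqNorm_comapDomain {J : Type} {f : J → S → T}
    (hf : Function.Injective fun p : S × J => f p.2 p.1) (hf' : ∀ j, Function.Injective (f j))
    (ξ : ι → MonoidAlgebra ℂ T)
    (hξ : ∀ i t, (∀ s j, f j s ≠ t) → (ξ i).coeff t = 0) :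
    ∑' j, sqNorm (fun i => comapDomain (f j) (hf' j) (ξ i)) = sqNorm ξ := by
  simp only [sqNorm]
  rw [ENNReal.tsum_comm]
  refine tsum_congr fun i => ?_
  rw [← hf.tsum_eq, ENNReal.tsum_prod', ENNReal.tsum_comm]
  · rfl
  · intro t ht
    by_contra h
    exact ht (by simp [hξ i t fun s j hs => h ⟨(s, j), hs⟩])

theorem comapDomain_sum' {κ : Type} {f : S → T} (hf : Function.Injective f) (s : Finset κ)
    (ξ : κ → MonoidAlgebra ℂ T) :
    comapDomain f hf (∑ i ∈ s, ξ i) = ∑ i ∈ s, comapDomain f hf (ξ i) :=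
  map_sum (comapDomainAddMonoidHom f hf) ξ s

/-- Restriction along an injective map, as a linear map. -/
def comapDomainLinearMap {f : S → T} (hf : Function.Injective f) :
    MonoidAlgebra ℂ T →ₗ[ℂ] MonoidAlgebra ℂ S where
  toFun := comapDomain f hf
  map_add' := comapDomain_add f hf
  map_smul' c x := by ext; simp

end MonoidAlgebra

open MonoidAlgebra

/-! ### Bifix codes -/

/-- A family of nonempty words, none of which is a prefix or a suffix of another one. -/
structure IsBifixCode {α β : Type} (f : β → FreeMonoid α) : Prop where
  ne_one : ∀ b, f b ≠ 1
  pre : ∀ {b c u v}, f b * u = f c * v → b = c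
  suf : ∀ {b c u v}, u * f b = v * f c → b = c

namespace IsBifixCode

variable {α β : Type} {f : β → FreeMonoid α}

/-- The words without a prefix in the code. -/
def Remainder (f : β → FreeMonoid α) : Type := {t : FreeMonoid α // ∀ b u, t ≠ f b * u}

/-- Uniqueness of the factorisation: the prefix condition forces equal first code words, which
cancel, and a remainder cannot begin with a code word. Existence is `exists_mul`. -/
theorem injective_mul (hf : IsBifixCode f) :
    Function.Injective fun p : FreeMonoid β × Remainder f => FreeMonoid.lift f p.1 * p.2.1 := by
  rintro ⟨u, t⟩ ⟨v, s⟩ h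
  induction u using FreeMonoid.inductionOn' generalizing v with
  | one =>
    induction v using FreeMonoid.casesOn with
    | one => exact Prod.ext rfl (Subtype.ext (by simpa using h))
    | of_mul c v => exact absurd (by simpa [mul_assoc] using h) (t.2 c (FreeMonoid.lift f v * s.1))
  | of_mul b u ih =>
    induction v using FreeMonoid.casesOn with
    | one =>
      exact absurd (by simpa [mul_assoc] using h.symm) (s.2 b (FreeMonoid.lift f u * t.1))
    | of_mul c v =>
      simp only [map_mul, FreeMonoid.lift_eval_of, mul_assoc] at h
      obtain rfl := hf.pre h
      have := ih v (mul_left_cancel h)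
      simp only [Prod.mk.injEq] at this ⊢
      exact ⟨by rw [this.1], this.2⟩

theorem exists_mul (hf : IsBifixCode f) (w : FreeMonoid α) :
    ∃ (u : FreeMonoid β) (t : Remainder f), FreeMonoid.lift f u * t.1 = w := by
  induction h : w.length using Nat.strong_induction_on generalizing w with
  | _ n ih =>
    by_cases hw : ∀ b u, w ≠ f b * u
    · exact ⟨1, ⟨w, hw⟩, by simp⟩
    · push Not at hw
      obtain ⟨b, u, rfl⟩ := hw
      have hb : (f b).length ≠ 0 := fun h0 => hf.ne_one b (FreeMonoid.length_eq_zero.1 h0)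
      rw [FreeMonoid.length_mul] at h
      obtain ⟨v, t, hv⟩ := ih u.length (by omega) u rfl
      exact ⟨FreeMonoid.of b * v, t, by simp [mul_assoc, hv]⟩

theorem injective_lift (hf : IsBifixCode f) : Function.Injective (FreeMonoid.lift f) := by
  intro u v h
  -- Code words are nonempty, so the empty word is a remainder, and unique factorisation applies
  -- with it.
  have h1 : ∀ b w, (1 : FreeMonoid α) ≠ f b * w := fun b w h => by
    have := congrArg FreeMonoid.length h
    rw [FreeMonoid.length_mul, FreeMonoid.length_one] at this
    exact hf.ne_one b (FreeMonoid.length_eq_zero.1 (by omega))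
  have := @injective_mul _ _ _ hf (u, ⟨1, h1⟩) (v, ⟨1, h1⟩) (by simpa using h)
  simpa using congrArg Prod.fst this

theorem injective_lift_mul (hf : IsBifixCode f) (t : Remainder f) :
    Function.Injective fun u => FreeMonoid.lift f u * t.1 :=
  fun u v h => congrArg Prod.fst (@injective_mul _ _ _ hf (u, t) (v, t) h)

/-- By the suffix condition the last code words on the two sides agree and cancel; what is left when
`u` is exhausted is again a product of code words. -/
theorem mem_range_of_mul (hf : IsBifixCode f) {w : FreeMonoid α} {u v : FreeMonoid β}
    (h : w * FreeMonoid.lift f u = FreeMonoid.lift f v) : ∃ w', FreeMonoid.lift f w' = w := by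
  have key : ∀ (l m : List β) (w : FreeMonoid α),
      w * (l.map f).prod = (m.map f).prod → ∃ w', FreeMonoid.lift f w' = w := by
    intro l
    induction l using List.reverseRecOn with
    | nil => exact fun m w h => ⟨FreeMonoid.ofList m, by simpa [FreeMonoid.lift_ofList] using h.symm⟩
    | append_singleton l b ih =>
      intro m w h
      rcases List.eq_nil_or_concat' m with rfl | ⟨m, c, rfl⟩
      · have := congrArg FreeMonoid.length h
        simp only [List.map_append, List.prod_append, FreeMonoid.length_mul, List.map_cons,
          List.map_nil, List.prod_cons, List.prod_nil, mul_one, FreeMonoid.length_one] at this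
        exact absurd (FreeMonoid.length_eq_zero.1 (by omega)) (hf.ne_one b)
      · simp only [List.map_append, List.prod_append, List.map_cons,
          List.map_nil, List.prod_cons, List.prod_nil, mul_one, ← mul_assoc] at h
        obtain rfl := hf.suf h
        exact ih m w (mul_right_cancel h)
  exact key (FreeMonoid.toList u) (FreeMonoid.toList v) w (by simpa [FreeMonoid.lift_apply] using h)

/-- Restriction of a product to the words of a code. -/
theorem comapDomain_mul_mapDomain (hf : IsBifixCode f) (a : MonoidAlgebra ℂ (FreeMonoid α))
    (b : MonoidAlgebra ℂ (FreeMonoid β)) :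
    comapDomain (FreeMonoid.lift f) hf.injective_lift (a * mapDomain (FreeMonoid.lift f) b) =
      comapDomain (FreeMonoid.lift f) hf.injective_lift a * b := by
  induction a using MonoidAlgebra.induction_linear with
  | zero => simp
  | add x y hx hy => rw [add_mul, comapDomain_add, hx, hy, comapDomain_add, add_mul]
  | single w r =>
    induction b using MonoidAlgebra.induction_linear with
    | zero => simp
    | add x y hx hy => rw [mapDomain_add, mul_add, comapDomain_add, hx, hy, mul_add]
    | single u s =>
      rw [mapDomain_single, single_mul_single]
      by_cases hw : w ∈ Set.range (FreeMonoid.lift f)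
      · obtain ⟨w, rfl⟩ := hw
        rw [← map_mul, comapDomain_single_map, comapDomain_single_map, single_mul_single]
      · rw [comapDomain_single_of_not_mem_range hw, comapDomain_single_of_not_mem_range, zero_mul]
        rintro ⟨v, hv⟩
        exact hw (hf.mem_range_of_mul hv.symm)

/-- The components of a product with an element supported on the submonoid spanned by the code. -/
theorem comapDomain_mapDomain_mul (hf : IsBifixCode f) (t : Remainder f)
    (a : MonoidAlgebra ℂ (FreeMonoid β)) (b : MonoidAlgebra ℂ (FreeMonoid α)) :
    comapDomain _ (hf.injective_lift_mul t) (mapDomain (FreeMonoid.lift f) a * b) =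
      a * comapDomain _ (hf.injective_lift_mul t) b := by
  induction a using MonoidAlgebra.induction_linear with
  | zero => simp
  | add x y hx hy => rw [mapDomain_add, add_mul, comapDomain_add, hx, hy, add_mul]
  | single w r =>
    induction b using MonoidAlgebra.induction_linear with
    | zero => simp
    | add x y hx hy => rw [mul_add, comapDomain_add, hx, hy, comapDomain_add, mul_add]
    | single v s =>
      obtain ⟨u, t', rfl⟩ := hf.exists_mul v
      rw [mapDomain_single, single_mul_single, ← mul_assoc, ← map_mul]
      by_cases ht : t' = t
      · subst ht
        rw [comapDomain_single_map (fun u => FreeMonoid.lift f u * t'.1),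
          comapDomain_single_map (fun u => FreeMonoid.lift f u * t'.1), single_mul_single]
      · have hrange : ∀ u, FreeMonoid.lift f u * t'.1 ∉
            Set.range fun u => FreeMonoid.lift f u * t.1 := by
          rintro u ⟨v, hv⟩
          exact ht (congrArg Prod.snd (@injective_mul _ _ _ hf (v, t) (u, t') hv)).symm
        rw [comapDomain_single_of_not_mem_range (hrange _),
          comapDomain_single_of_not_mem_range (hrange _), mul_zero]

end IsBifixCode

/-! ### The free monoid algebra as a space of left multiplication operators -/

/-- The free monoid algebra, acting on itself by left multiplication. -/
def wordSpace (α : Type) : ColumnSpace where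
  carrier := MonoidAlgebra ℂ (FreeMonoid α)
  Bound {ι n} x c := ∀ ξ : Fin n → MonoidAlgebra ℂ (FreeMonoid α),
    sqNorm (fun i => ∑ j, x i j * ξ j) ≤ c * sqNorm ξ
  bound_mono hcd h ξ := (h ξ).trans (by gcongr)
  bound_add {ι n x y c} h h' ξ := by
    have : (fun i => ∑ j, (x + y) i j * ξ j) =
        (fun i => ∑ j, x i j * ξ j) + fun i => ∑ j, y i j * ξ j := by
      ext1 i
      simp [add_mul, Finset.sum_add_distrib]
    rw [this]
    -- The 4 in `bound_add` is 2(c + c) = 4c.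
    refine (sqNorm_add_le _ _).trans ((mul_le_mul_right (add_le_add (h ξ) (h' ξ)) 2).trans_eq ?_)
    ring
  bound_neg {ι n x c} h ξ := by
    have : (fun i => ∑ j, (-x) i j * ξ j) = -fun i => ∑ j, x i j * ξ j := by
      ext1 i
      simp
    rw [this, sqNorm_neg]
    exact h ξ
  bound_comp {ι ι' n x c f} hf h ξ :=
    (sqNorm_comp_le hf fun i => ∑ j, x i j * ξ j).trans (h ξ)
  bound_sum {ι ι' n x c} h h' ξ := by
    rw [sqNorm_sum, two_mul, add_mul]
    exact add_le_add (h ξ) (h' ξ)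

open ColumnSpace

variable {α β : Type}

/-- Both sides split as orthogonal sums over the remainders `t`; on each summand the lifted array
acts as the original one, and the bounds are summed over `t`. -/
theorem IsBifixCode.isCB_mapDomain {f : β → FreeMonoid α} (hf : IsBifixCode f) :
    IsCB (X := wordSpace β) (Y := wordSpace α)
      (MonoidAlgebra.mapDomainAlgHom ℂ ℂ (FreeMonoid.lift f)).toLinearMap := by
  refine isCB_of_forall fun {ι n} x c h (ξ : Fin n → MonoidAlgebra ℂ (FreeMonoid α)) => ?_
  have hz : ∀ {κ : Type} (ξ : κ → MonoidAlgebra ℂ (FreeMonoid α)),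
      ∑' t, sqNorm (fun i => comapDomain _ (hf.injective_lift_mul t) (ξ i)) = sqNorm ξ :=
    fun ξ => tsum_sqNorm_comapDomain (f := fun (t : Remainder f) u => FreeMonoid.lift f u * t.1)
      hf.injective_mul hf.injective_lift_mul ξ fun i w hw => by
        obtain ⟨u, t, hut⟩ := hf.exists_mul w
        exact absurd hut (hw u t)
  rw [← hz ξ, ← ENNReal.tsum_mul_left, ← hz]
  refine ENNReal.tsum_le_tsum fun t => ?_
  refine le_trans (le_of_eq (congrArg sqNorm (funext fun i => ?_)))
    (h fun j => comapDomain _ (hf.injective_lift_mul t) (ξ j))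
  rw [comapDomain_sum']
  exact Finset.sum_congr rfl fun j _ => hf.comapDomain_mapDomain_mul t _ _

/-- This is the compression V*aV, with V the isometry which spells words in the code; neither V nor
V* increases norms. -/
theorem IsBifixCode.isCB_comapDomain {f : β → FreeMonoid α} (hf : IsBifixCode f) :
    IsCB (X := wordSpace α) (Y := wordSpace β) (comapDomainLinearMap hf.injective_lift) := by
  refine isCB_of_forall fun {ι n} x c h (ξ : Fin n → MonoidAlgebra ℂ (FreeMonoid β)) => ?_
  rw [← sqNorm_mapDomain hf.injective_lift ξ]
  refine le_trans (le_of_eq (congrArg sqNorm (funext fun i => ?_)))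
    ((sqNorm_comapDomain_le hf.injective_lift _).trans
      (h fun j => mapDomain (FreeMonoid.lift f) (ξ j)))
  rw [comapDomain_sum']
  exact Finset.sum_congr rfl fun j _ => (hf.comapDomain_mul_mapDomain _ _).symm

theorem IsBifixCode.retract {f : β → FreeMonoid α} (hf : IsBifixCode f) :
    Retract (wordSpace β) (wordSpace α) := by
  refine ⟨_, _, hf.isCB_mapDomain, hf.isCB_comapDomain,
    fun x : MonoidAlgebra ℂ (FreeMonoid β) => ?_⟩
  refine MonoidAlgebra.ext (Finsupp.ext fun w => ?_)
  exact Finsupp.mapDomain_apply hf.injective_lift _ _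

/-! ### Columns over the free monoid algebra -/

/-- The column `(y_g)` is mapped to `∑ g y_g`, with `g` the generators. -/
def ofColumn (α : Type) :
    (α →₀ MonoidAlgebra ℂ (FreeMonoid α)) →ₗ[ℂ] MonoidAlgebra ℂ (FreeMonoid α) :=
  Finsupp.lsum ℂ fun g => LinearMap.mulLeft ℂ (single (FreeMonoid.of g) 1)

theorem injective_of_mul (g : α) : Function.Injective fun w => FreeMonoid.of g * w :=
  mul_right_injective _

/-- The column of the backward shifts of an element. -/
def toColumn (α : Type) :
    MonoidAlgebra ℂ (FreeMonoid α) →ₗ[ℂ] α →₀ MonoidAlgebra ℂ (FreeMonoid α) :=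
  (Finsupp.linearCombination ℂ fun w : FreeMonoid α => FreeMonoid.casesOn w 0
    fun g v => Finsupp.single g (single v 1)) ∘ₗ (MonoidAlgebra.coeffLinearEquiv ℂ).toLinearMap

theorem toColumn_single_one (r : ℂ) : toColumn α (single 1 r) = 0 := by
  simp [toColumn]

theorem toColumn_single_mul (g : α) (v : FreeMonoid α) (r : ℂ) :
    toColumn α (single (FreeMonoid.of g * v) r) = Finsupp.single g (single v r) := by
  simp [toColumn]

theorem ofColumn_single (g : α) (b : MonoidAlgebra ℂ (FreeMonoid α)) :
    ofColumn α (Finsupp.single g b) = single (FreeMonoid.of g) 1 * b := by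
  simp [ofColumn]

theorem comapDomain_single_of_mul (g h : α) (b : MonoidAlgebra ℂ (FreeMonoid α)) :
    comapDomain _ (injective_of_mul g) (single (FreeMonoid.of h) 1 * b) =
      Finsupp.single h b g := by
  induction b using MonoidAlgebra.induction_linear with
  | zero => simp
  | add x y hx hy => simp [mul_add, comapDomain_add, hx, hy]
  | single w r =>
    rw [single_mul_single, one_mul]
    by_cases hg : g = h
    · subst hg
      rw [comapDomain_single_map (fun w => FreeMonoid.of g * w), Finsupp.single_eq_same]
    · rw [comapDomain_single_of_not_mem_range, Finsupp.single_eq_of_ne hg]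
      rintro ⟨v, hv⟩
      exact hg (List.cons.inj hv).1

theorem comapDomain_ofColumn_mul (g : α) (y : α →₀ MonoidAlgebra ℂ (FreeMonoid α))
    (b : MonoidAlgebra ℂ (FreeMonoid α)) :
    comapDomain _ (injective_of_mul g) (ofColumn α y * b) = y g * b := by
  induction y using Finsupp.induction_linear with
  | zero => simp
  | add x y hx hy => simp [add_mul, comapDomain_add, hx, hy]
  | single h a =>
    rw [ofColumn_single, mul_assoc, comapDomain_single_of_mul]
    by_cases hg : g = h
    · subst hg
      simp
    · simp [Finsupp.single_eq_of_ne hg]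

theorem coeff_ofColumn_mul_eq_zero (y : α →₀ MonoidAlgebra ℂ (FreeMonoid α))
    (b : MonoidAlgebra ℂ (FreeMonoid α)) {t : FreeMonoid α}
    (ht : ∀ v g, FreeMonoid.of g * v ≠ t) : (ofColumn α y * b).coeff t = 0 := by
  induction y using Finsupp.induction_linear with
  | zero => simp
  | add x y hx hy => simp [add_mul, hx, hy]
  | single h a =>
    rw [ofColumn_single, mul_assoc]
    exact coeff_single_mul_of_forall_mul_ne _ _ fun v => ht v h

theorem toColumn_ofColumn (y : α →₀ MonoidAlgebra ℂ (FreeMonoid α)) :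
    toColumn α (ofColumn α y) = y := by
  induction y using Finsupp.induction_linear with
  | zero => simp
  | add x y hx hy => simp [hx, hy]
  | single g a =>
    rw [ofColumn_single]
    induction a using MonoidAlgebra.induction_linear with
    | zero => simp
    | add x y hx hy => simp [mul_add, hx, hy]
    | single w r => rw [single_mul_single, one_mul, toColumn_single_mul]

/-- Pythagoras: left multiplications by distinct letters are isometries with orthogonal ranges,
since a nonempty word determines its first letter. -/
theorem sqNorm_sum_ofColumn_mul {ι : Type} {n : ℕ}
    (x : ι → Fin n → α →₀ MonoidAlgebra ℂ (FreeMonoid α))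
    (ξ : Fin n → MonoidAlgebra ℂ (FreeMonoid α)) :
    sqNorm (fun i => ∑ j, ofColumn α (x i j) * ξ j) =
      sqNorm fun i : ι × α => ∑ j, x i.1 j i.2 * ξ j := by
  rw [sqNorm_prod, ← tsum_sqNorm_comapDomain (f := fun (g : α) w => FreeMonoid.of g * w)
    (hf' := injective_of_mul)]
  · simp [comapDomain_sum', comapDomain_ofColumn_mul]
  · rintro ⟨u, g⟩ ⟨v, h⟩ huv
    obtain ⟨h1, h2⟩ := List.cons.inj huv
    exact Prod.ext h2 h1
  · intro i t ht
    rw [MonoidAlgebra.coeff_sum, Finsupp.finsetSum_apply]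
    exact Finset.sum_eq_zero fun j _ => coeff_ofColumn_mul_eq_zero _ _ ht

theorem bound_ofColumn_iff {ι : Type} {n : ℕ}
    (x : ι → Fin n → α →₀ MonoidAlgebra ℂ (FreeMonoid α)) (c : ℝ≥0∞) :
    (wordSpace α).Bound (fun i j => ofColumn α (x i j)) c ↔
      (col α (wordSpace α)).Bound x c :=
  forall_congr' fun ξ => by
    rw [sqNorm_sum_ofColumn_mul]
    rfl

/-- The submonoid generated by the empty code is {1}, so its retraction is the constant term, whose
complete boundedness thus comes from the general theory of codes. -/
theorem isBifixCode_empty : IsBifixCode (fun b : Empty => (b.elim : FreeMonoid α)) :=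
  ⟨fun b => b.elim, fun {b} => b.elim, fun {b} => b.elim⟩

theorem ofColumn_toColumn (a : MonoidAlgebra ℂ (FreeMonoid α)) :
    ofColumn α (toColumn α a) = a - mapDomain (FreeMonoid.lift fun b : Empty => b.elim)
      (comapDomain _ (isBifixCode_empty (α := α)).injective_lift a) := by
  induction a using MonoidAlgebra.induction_linear with
  | zero => simp
  | add x y hx hy =>
    rw [map_add, map_add, hx, hy, comapDomain_add, mapDomain_add]
    abel
  | single w r =>
    induction w using FreeMonoid.casesOn with
    | one =>
      rw [toColumn_single_one, map_zero]
      conv_rhs => rw [← map_one (FreeMonoid.lift fun b : Empty => (b.elim : FreeMonoid α))]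
      rw [comapDomain_single_map, mapDomain_single, sub_self]
    | of_mul g v =>
      rw [toColumn_single_mul, ofColumn_single, single_mul_single, one_mul,
        comapDomain_single_of_not_mem_range, mapDomain_zero, sub_zero]
      rintro ⟨u, hu⟩
      obtain rfl : u = 1 := Subsingleton.elim (α := List Empty) u []
      exact List.cons_ne_nil _ _ hu.symm

/-- Because `ofColumn` preserves bounds exactly, `toColumn` is bounded as soon as `ofColumn ∘
toColumn` is, and the latter only removes the constant term. -/
theorem retract_col_wordSpace : Retract (col α (wordSpace α)) (wordSpace α) := by
  refine ⟨ofColumn α, toColumn α,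
    isCB_of_forall fun x c h => (bound_ofColumn_iff x c).2 h, ?_, toColumn_ofColumn⟩
  obtain ⟨K, hK⟩ := isCB_id.sub ((isBifixCode_empty (α := α)).isCB_mapDomain.comp
    isBifixCode_empty.isCB_comapDomain)
  refine ⟨K, fun x c h => (bound_ofColumn_iff _ _).1 ?_⟩
  exact (congrArg ((wordSpace α).Bound · (K * c))
    (funext₂ fun i j => ofColumn_toColumn (x i j))).mpr (hK x c h)

/-! ### The codes -/

theorem IsBifixCode.of_injective {e : β → α} (he : Function.Injective e) :
    IsBifixCode fun b => FreeMonoid.of (e b) where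
  ne_one b := FreeMonoid.of_ne_one _
  pre h := he (List.cons.inj h).1
  suf {b c u v} h := he <| by
    have := congrArg FreeMonoid.reverse h
    simp only [FreeMonoid.reverse_mul] at this
    exact (List.cons.inj this).1

/-- The word `a bⁿ a`. -/
def bracketWord (a b : α) (n : ℕ) : FreeMonoid α :=
  FreeMonoid.ofList (a :: (List.replicate n b ++ [a]))

/-- After the initial a, the number of b's before the next a reveals n, which gives the prefix
condition. The words are palindromes, so reversal gives the suffix condition. -/
theorem isBifixCode_bracketWord {a b : α} (hab : a ≠ b) : IsBifixCode (bracketWord a b) := by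
  have key : ∀ (m n : ℕ) (u v : List α),
      List.replicate m b ++ a :: u = List.replicate n b ++ a :: v → m = n := by
    intro m
    induction m with
    | zero =>
      intro n u v h
      cases n with
      | zero => rfl
      | succ n => exact absurd (List.cons.inj h).1 hab
    | succ m ih =>
      intro n u v h
      cases n with
      | zero => exact absurd (List.cons.inj h).1.symm hab
      | succ n => exact congrArg _ (ih n u v (List.cons.inj h).2)
  have pre : ∀ {m n : ℕ} {u v : FreeMonoid α},
      bracketWord a b m * u = bracketWord a b n * v → m = n := fun {m n u v} h => by
    refine key m n (FreeMonoid.toList u) (FreeMonoid.toList v) ?_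
    simpa [bracketWord] using congrArg FreeMonoid.toList h
  have hrev : ∀ n, (bracketWord a b n).reverse = bracketWord a b n := fun n =>
    congrArg FreeMonoid.ofList (by simp)
  refine ⟨fun n => List.cons_ne_nil _ _, pre, fun {m n u v} h => ?_⟩
  have := congrArg FreeMonoid.reverse h
  rw [FreeMonoid.reverse_mul, FreeMonoid.reverse_mul, hrev, hrev] at this
  exact pre this

theorem equivalent_wordSpace {k : ℕ} (hk : 2 ≤ k) :
    Equivalent (wordSpace (Fin k)) (wordSpace ℕ) :=
  equivalent_of_retract (IsBifixCode.of_injective Fin.val_injective).retract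
    (isBifixCode_bracketWord (a := (⟨0, by omega⟩ : Fin k)) (b := ⟨1, by omega⟩)
      (Fin.ne_of_val_ne zero_ne_one)).retract
    retract_col_wordSpace

namespace NCDisc

variable {α : Type}

/-! ### Elements of the free monoid algebra as operators and as vectors -/

/-- The left multiplication operator on the Fock space of an element of the free monoid algebra. -/
def leftMulPoly (α : Type) :
    MonoidAlgebra ℂ (FreeMonoid α) →ₗ[ℂ] FockSpace α →L[ℂ] FockSpace α :=
  Finsupp.linearCombination ℂ leftMul ∘ₗ (MonoidAlgebra.coeffLinearEquiv ℂ).toLinearMap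

/-- The vector of finite support with the same coefficients. -/
def vector (α : Type) : MonoidAlgebra ℂ (FreeMonoid α) →ₗ[ℂ] FockSpace α :=
  Finsupp.linearCombination ℂ basisVec ∘ₗ (MonoidAlgebra.coeffLinearEquiv ℂ).toLinearMap

theorem leftMulPoly_single (w : FreeMonoid α) (r : ℂ) :
    leftMulPoly α (single w r) = r • leftMul w := by
  simp [leftMulPoly]

theorem vector_single (w : FreeMonoid α) (r : ℂ) :
    vector α (single w r) = r • basisVec w := by
  simp [vector]

theorem range_leftMulPoly : LinearMap.range (leftMulPoly α) = polynomials α := by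
  rw [leftMulPoly, LinearEquiv.range_comp, Finsupp.range_linearCombination, polynomials]

theorem leftMulPoly_vector (a b : MonoidAlgebra ℂ (FreeMonoid α)) :
    leftMulPoly α a (vector α b) = vector α (a * b) := by
  induction a using MonoidAlgebra.induction_linear with
  | zero => simp
  | add x y hx hy => simp [add_mul, hx, hy]
  | single w r =>
    induction b using MonoidAlgebra.induction_linear with
    | zero => simp
    | add x y hx hy => simp only [mul_add, map_add, hx, hy]
    | single v s =>
      simp [single_mul_single, leftMulPoly_single, vector_single, leftMul_basisVec, smul_smul,
        mul_comm]

theorem vector_apply (a : MonoidAlgebra ℂ (FreeMonoid α)) (w : FreeMonoid α) :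
    vector α a w = a.coeff w := by
  classical
  induction a using MonoidAlgebra.induction_linear with
  | zero => simp
  | add x y hx hy => simp [hx, hy]
  | single v r =>
    rw [vector_single, lp.coeFn_smul, Pi.smul_apply, basisVec, lp.single_apply, coeff_single,
      Finsupp.single_apply, Pi.single_apply]
    simp [eq_comm]

theorem enorm_vector_sq (a : MonoidAlgebra ℂ (FreeMonoid α)) :
    ‖vector α a‖ₑ ^ 2 = ∑' w, ‖a.coeff w‖ₑ ^ 2 := by
  have h := lp.hasSum_norm (p := 2) (by norm_num) (vector α a)
  simp only [ENNReal.toReal_ofNat, Real.rpow_ofNat, vector_apply] at h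
  simp only [← ofReal_norm, ← ENNReal.ofReal_pow (norm_nonneg _)]
  rw [← h.tsum_eq, ENNReal.ofReal_tsum_of_nonneg (fun _ => by positivity) h.summable]

theorem denseRange_vector : DenseRange (vector α) := by
  classical
  intro f
  refine mem_closure_of_tendsto (lp.hasSum_single (by simp) f) (.of_forall fun s => ?_)
  refine ⟨∑ w ∈ s, single w (f w), ?_⟩
  rw [map_sum]
  refine Finset.sum_congr rfl fun w _ => ?_
  rw [vector_single, basisVec, ← lp.single_smul, smul_eq_mul, mul_one]

/-- The vector of the direct sum of copies of the Fock space with given components. -/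
def vectors {n : ℕ} (ξ : Fin n → MonoidAlgebra ℂ (FreeMonoid α)) :
    PiLp 2 fun _ : Fin n => FockSpace α :=
  WithLp.toLp 2 fun i => vector α (ξ i)

theorem enorm_vectors_sq {n : ℕ} (ξ : Fin n → MonoidAlgebra ℂ (FreeMonoid α)) :
    ‖vectors ξ‖ₑ ^ 2 = sqNorm ξ := by
  rw [sqNorm, tsum_fintype, ← ofReal_norm, ← ENNReal.ofReal_pow (norm_nonneg _),
    PiLp.norm_sq_eq_of_L2, ENNReal.ofReal_sum_of_nonneg fun _ _ => by positivity]
  refine Finset.sum_congr rfl fun i _ => ?_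
  rw [← enorm_vector_sq, ENNReal.ofReal_pow (norm_nonneg _), ofReal_norm]
  rfl

theorem denseRange_vectors {n : ℕ} :
    DenseRange (vectors : (Fin n → MonoidAlgebra ℂ (FreeMonoid α)) → _) :=
  (PiLp.continuousLinearEquiv 2 ℂ fun _ : Fin n => FockSpace α).symm.surjective.denseRange.comp
    (DenseRange.piMap fun _ => denseRange_vector) (ContinuousLinearEquiv.continuous _)

theorem matrixOp_vectors {n : ℕ} (x : Fin n → Fin n → MonoidAlgebra ℂ (FreeMonoid α))
    (ξ : Fin n → MonoidAlgebra ℂ (FreeMonoid α)) :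
    matrixOp (.of fun i j => leftMulPoly α (x i j)) (vectors ξ) =
      vectors fun i => ∑ j, x i j * ξ j := by
  refine PiLp.ext fun i => ?_
  rw [matrixOp_apply]
  simp [vectors, leftMulPoly_vector]

/-- The polynomial bound tests the operator on finitely supported vectors only; these are dense, so
it determines the operator norm. -/
theorem norm_matrixOp_le_iff {n : ℕ} (x : Fin n → Fin n → MonoidAlgebra ℂ (FreeMonoid α)) {c : ℝ}
    (hc : 0 ≤ c) : ‖matrixOp (.of fun i j => leftMulPoly α (x i j))‖ ≤ c ↔
      (wordSpace α).Bound x (ENNReal.ofReal c ^ 2) := by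
  have key : ∀ ξ : Fin n → MonoidAlgebra ℂ (FreeMonoid α),
      ‖matrixOp (.of fun i j => leftMulPoly α (x i j)) (vectors ξ)‖ ≤ c * ‖vectors ξ‖ ↔
        sqNorm (fun i => ∑ j, x i j * ξ j) ≤ ENNReal.ofReal c ^ 2 * sqNorm ξ := fun ξ => by
    rw [matrixOp_vectors, ← enorm_vectors_sq, ← enorm_vectors_sq, ← mul_pow,
      (ENNReal.pow_right_strictMono two_ne_zero).le_iff_le, ← ofReal_norm, ← ofReal_norm, ← ENNReal.ofReal_mul hc,
      ENNReal.ofReal_le_ofReal_iff (by positivity)]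
  rw [ContinuousLinearMap.opNorm_le_iff hc]
  refine ⟨fun h ξ => (key ξ).1 (h _), fun h η => ?_⟩
  exact denseRange_vectors.induction_on η (isClosed_le (by fun_prop) (by fun_prop))
    fun ξ => (key ξ).2 (h ξ)

/-! ### Extension to the closures -/

/-- The elements of the free monoid algebra as elements of the noncommutative disc algebra. -/
def toDiscAlgebra (α : Type) : MonoidAlgebra ℂ (FreeMonoid α) →ₗ[ℂ] discAlgebra α :=
  (leftMulPoly α).codRestrict _ fun a =>
    (polynomials α).le_topologicalClosure (range_leftMulPoly (α := α) ▸ LinearMap.mem_range_self _ a)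

theorem denseRange_toDiscAlgebra : DenseRange (toDiscAlgebra α) := by
  rintro ⟨a, ha⟩
  rw [closure_subtype]
  have : (Subtype.val '' Set.range (toDiscAlgebra α)) = (polynomials α : Set _) := by
    rw [← range_leftMulPoly, LinearMap.coe_range, ← Set.range_comp]
    rfl
  rw [this]
  exact ha

theorem exists_continuousLinearEquiv_extend {V W E F : Type*} [NormedAddCommGroup V]
    [NormedSpace ℂ V] [CompleteSpace V] [NormedAddCommGroup W] [NormedSpace ℂ W] [CompleteSpace W]
    [AddCommGroup E] [Module ℂ E] [AddCommGroup F] [Module ℂ F] (v : E ≃ₗ[ℂ] F)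
    {p : E →ₗ[ℂ] V} {q : F →ₗ[ℂ] W} (hp : DenseRange p) (hq : DenseRange q)
    (hc : ∃ C, ∀ x, ‖q (v x)‖ ≤ C * ‖p x‖) (hd : ∃ C, ∀ x, ‖p (v.symm x)‖ ≤ C * ‖q x‖) :
    ∃ e : V ≃L[ℂ] W, (∀ x, e (p x) = q (v x)) ∧ ∀ x, e.symm (q x) = p (v.symm x) :=
  ⟨v.extend p q hp hc hq hd, fun _ => LinearEquiv.extend_eq .., fun _ =>
    LinearEquiv.extend_symm_eq ..⟩

section

variable {H : Type*} [NormedAddCommGroup H] [InnerProductSpace ℂ H]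

/-- In this form continuity in the entries is evident. -/
theorem matrixOp_eq_sum {n : ℕ} (x : Matrix (Fin n) (Fin n) (H →L[ℂ] H)) :
    matrixOp x = ∑ i, ∑ j,
      (((PiLp.continuousLinearEquiv 2 ℂ (fun _ : Fin n => H)).symm :
        (Fin n → H) →L[ℂ] PiLp 2 (fun _ : Fin n => H)).comp
          (ContinuousLinearMap.single ℂ (fun _ => H) i)).comp
        ((x i j).comp (PiLp.proj 2 (fun _ : Fin n => H) j)) := by
  refine ContinuousLinearMap.ext fun ξ => PiLp.ext fun k => ?_
  rw [matrixOp_apply]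
  simp [Pi.single_apply, Finset.sum_ite_eq]

theorem continuous_sum_comp_comp {V : Type*} [NormedAddCommGroup V] [NormedSpace ℂ V] {n : ℕ}
    (A : Fin n → H →L[ℂ] V) (B : Fin n → V →L[ℂ] H) :
    Continuous fun x : Matrix (Fin n) (Fin n) (H →L[ℂ] H) =>
      ∑ i, ∑ j, (A i).comp ((x i j).comp (B j)) :=
  continuous_finsetSum _ fun i _ => continuous_finsetSum _ fun j _ =>
    continuous_const.clm_comp ((continuous_id.matrix_elem i j).clm_comp continuous_const)

theorem continuous_norm_matrixOp (n : ℕ) :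
    Continuous fun x : Matrix (Fin n) (Fin n) (H →L[ℂ] H) => ‖matrixOp x‖ := by
  simp only [matrixOp_eq_sum]
  exact (continuous_sum_comp_comp _ _).norm

theorem continuous_matrixNorm (X : Submodule ℂ (H →L[ℂ] H)) (n : ℕ) :
    Continuous fun x : Matrix (Fin n) (Fin n) X => matrixNorm X x :=
  (continuous_norm_matrixOp n).comp (continuous_id.matrix_map continuous_subtype_val)

theorem matrixNorm_fin_one (X : Submodule ℂ (H →L[ℂ] H)) (a : X) :
    matrixNorm X (.of fun _ _ : Fin 1 => a) = ‖a‖ := by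
  refine le_antisymm (ContinuousLinearMap.opNorm_le_bound _ (norm_nonneg _) fun ξ => ?_)
    (ContinuousLinearMap.opNorm_le_bound (a : H →L[ℂ] H)
      (norm_nonneg (matrixOp (H := H) (n := 1) _)) fun ξ => ?_)
  · rw [PiLp.norm_eq_of_L2, PiLp.norm_eq_of_L2]
    simpa [matrixOp_apply] using (a : H →L[ℂ] H).le_opNorm (ξ 0)
  · have := (matrixOp ((Matrix.of fun _ _ : Fin 1 => a).map
      fun a => (a : H →L[ℂ] H))).le_opNorm (WithLp.toLp 2 fun _ => ξ)
    rw [PiLp.norm_eq_of_L2, PiLp.norm_eq_of_L2] at this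
    simpa [matrixOp_apply, matrixNorm] using this

variable {K : Type*} [NormedAddCommGroup K] [InnerProductSpace ℂ K]
  {X : Submodule ℂ (H →L[ℂ] H)} {Y : Submodule ℂ (K →L[ℂ] K)}

/-- For each fixed n both matrix norms are continuous in the entries, so the inequality passes to
the closure with the same `c`, which does not depend on n. -/
theorem completelyBounded_of_denseRange {E : Type*} {p : E → X} (hp : DenseRange p) (u : X →L[ℂ] Y) {c : ℝ}
    (h : ∀ (n : ℕ) (x : Fin n → Fin n → E),
      matrixNorm Y (.of fun i j => u (p (x i j))) ≤ c * matrixNorm X (.of fun i j => p (x i j))) :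
    CompletelyBounded (u : X →ₗ[ℂ] Y) := by
  refine ⟨c, fun n x => ?_⟩
  have hd : DenseRange fun x : Fin n → Fin n → E => (Matrix.of fun i j => p (x i j)) :=
    DenseRange.piMap fun _ => DenseRange.piMap fun _ => hp
  exact hd.induction_on x (isClosed_le
    ((continuous_matrixNorm _ n).comp (continuous_id.matrix_map u.continuous))
    ((continuous_matrixNorm _ n).const_mul c)) (h n)

/-- A linear bijection between dense subspaces, completely bounded in both directions, extends. -/
theorem completelyIsomorphic_of_denseRange {E F : Type*} [AddCommGroup E]
    [Module ℂ E] [AddCommGroup F] [Module ℂ F] [CompleteSpace X] [CompleteSpace Y] (v : E ≃ₗ[ℂ] F)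
    {p : E →ₗ[ℂ] X} {q : F →ₗ[ℂ] Y} (hp : DenseRange p) (hq : DenseRange q) {c d : ℝ}
    (hc : ∀ (n : ℕ) (x : Fin n → Fin n → E),
      matrixNorm Y (.of fun i j => q (v (x i j))) ≤ c * matrixNorm X (.of fun i j => p (x i j)))
    (hd : ∀ (n : ℕ) (x : Fin n → Fin n → F),
      matrixNorm X (.of fun i j => p (v.symm (x i j))) ≤
        d * matrixNorm Y (.of fun i j => q (x i j))) :
    CompletelyIsomorphic X Y := by
  -- The case of 1 × 1 matrices is ordinary boundedness, which is what the extension by density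
  -- requires.
  have hc1 : ∃ C, ∀ x, ‖q (v x)‖ ≤ C * ‖p x‖ := ⟨c, fun x => by
    simpa only [matrixNorm_fin_one] using hc 1 fun _ _ => x⟩
  have hd1 : ∃ C, ∀ x, ‖p (v.symm x)‖ ≤ C * ‖q x‖ := ⟨d, fun x => by
    simpa only [matrixNorm_fin_one] using hd 1 fun _ _ => x⟩
  obtain ⟨e, he, he'⟩ : ∃ e : X ≃L[ℂ] Y,
      (∀ x, e (p x) = q (v x)) ∧ ∀ x, e.symm (q x) = p (v.symm x) := by
    refine exists_continuousLinearEquiv_extend (V := X) (W := Y) v (p := p) (q := q) ?_ ?_ ?_ ?_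
    exacts [hp, hq, hc1, hd1]
  refine ⟨e.toLinearEquiv, completelyBounded_of_denseRange (c := c) hp (e : X →L[ℂ] Y) fun n x => ?_,
    completelyBounded_of_denseRange (c := d) hq (e.symm : Y →L[ℂ] X) fun n x => ?_⟩
  · simpa only [ContinuousLinearEquiv.coe_coe, he] using hc n x
  · simpa only [ContinuousLinearEquiv.coe_coe, he'] using hd n x

end

/-! ### From polynomials to the disc algebras -/

theorem exists_matrixNorm_le {β : Type} {u : wordSpace α →ₗ[ℂ] wordSpace β} (hu : IsCB u) :
    ∃ c : ℝ, ∀ (n : ℕ) (x : Fin n → Fin n → MonoidAlgebra ℂ (FreeMonoid α)),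
      matrixNorm (discAlgebra β) (.of fun i j => toDiscAlgebra β (u (x i j))) ≤
        c * matrixNorm (discAlgebra α) (.of fun i j => toDiscAlgebra α (x i j)) := by
  obtain ⟨K, hK⟩ := hu
  -- `K` bounds squared norms, hence the square root.
  refine ⟨Real.sqrt K, fun n x => ?_⟩
  have h := hK x _ ((norm_matrixOp_le_iff x (norm_nonneg _)).1 le_rfl)
  refine (norm_matrixOp_le_iff (fun i j => u (x i j))
    (mul_nonneg (Real.sqrt_nonneg _) (norm_nonneg _))).2 ?_
  refine (congrArg ((wordSpace β).Bound fun i j => u (x i j)) ?_).mp h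
  rw [ENNReal.ofReal_mul (Real.sqrt_nonneg _), mul_pow, ← ENNReal.ofReal_pow (Real.sqrt_nonneg _),
    Real.sq_sqrt K.coe_nonneg, ENNReal.ofReal_coe_nnreal]
  rfl

theorem completelyIsomorphic_of_equivalent {β : Type}
    (h : Equivalent (wordSpace α) (wordSpace β)) :
    CompletelyIsomorphic (discAlgebra α) (discAlgebra β) := by
  have : CompleteSpace (discAlgebra α) :=
    (polynomials α).isClosed_topologicalClosure.completeSpace_coe
  have : CompleteSpace (discAlgebra β) :=
    (polynomials β).isClosed_topologicalClosure.completeSpace_coe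
  obtain ⟨u, hu, hv⟩ := h
  obtain ⟨c, hc⟩ := exists_matrixNorm_le hu
  obtain ⟨d, hd⟩ := exists_matrixNorm_le hv
  exact completelyIsomorphic_of_denseRange
    (E := MonoidAlgebra ℂ (FreeMonoid α)) (F := MonoidAlgebra ℂ (FreeMonoid β)) u
    denseRange_toDiscAlgebra denseRange_toDiscAlgebra hc hd

end NCDisc

end

theorem theorem10 (k : ℕ) (hk : 2 ≤ k) :
    NCDisc.CompletelyIsomorphic (NCDisc.discAlgebra (Fin k)) (NCDisc.discAlgebra ℕ) :=
  NCDisc.completelyIsomorphic_of_equivalent (equivalent_wordSpace hk)
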